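/- Let $\mu\in\mathbb{Z}$, and let $S_n=S_n(z;\mu)\in\mathbb{C}(z)$, $n\ge -1$, be the sequence of rational functions generated by $S_{-1}=S_0=1$ and the recurrence relation $$S_{n+1}S_{n-1}=-z\left[S_n\frac{d^2S_n}{dz^2}-\left(\frac{dS_n}{dz}\right)^2\right]-S_n\frac{dS_n}{dz}+(z+\mu)S_n^2,\qquad n\ge 0.$$ Then for every integer $n>|\mu|$: (a) $z=0$ is a root of $S_n$ of order exactly $\tfrac12(n-|\mu|)(n-|\mu|+1)$; (b) $S_n$ is a monic polynomial in $z$ of degree $\tfrac12 n(n+1)$; (c) every other root of $S_n$ in $\mathbb{C}$ is simple. -/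

import Mathlib

open Polynomial

/-- The derivative `d/dz` of a rational function, by the quotient rule applied to the reduced
fraction `f = num / denom`. -/
noncomputable def ratDeriv (f : RatFunc ℂ) : RatFunc ℂ :=
  algebraMap ℂ[X] (RatFunc ℂ)
      (derivative f.num * f.denom - f.num * derivative f.denom) /
    algebraMap ℂ[X] (RatFunc ℂ) f.denom ^ 2

/-- The quotient rule holds for every presentation of a rational function as a fraction,
so `ratDeriv` does not depend on the choice of the reduced one. -/
theorem ratDeriv_div (p q : ℂ[X]) (hq : q ≠ 0) :
    ratDeriv (algebraMap ℂ[X] (RatFunc ℂ) p / algebraMap ℂ[X] (RatFunc ℂ) q) =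
      algebraMap ℂ[X] (RatFunc ℂ) (derivative p * q - p * derivative q) /
        algebraMap ℂ[X] (RatFunc ℂ) q ^ 2 := by
  generalize hf : algebraMap ℂ[X] (RatFunc ℂ) p / algebraMap ℂ[X] (RatFunc ℂ) q = f
  have h : f.num * q = p * f.denom := (RatFunc.num_mul_eq_mul_denom_iff hq).mpr hf.symm
  have hq' : algebraMap ℂ[X] (RatFunc ℂ) q ≠ 0 := RatFunc.algebraMap_ne_zero hq
  have hd' : algebraMap ℂ[X] (RatFunc ℂ) f.denom ≠ 0 :=
    RatFunc.algebraMap_ne_zero f.denom_ne_zero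
  unfold ratDeriv
  generalize f.num = N at h ⊢
  generalize f.denom = D at h hd' ⊢
  have h' := congrArg derivative h
  simp only [derivative_mul] at h'
  have key : (derivative N * D - N * derivative D) * q ^ 2 =
      (derivative p * q - p * derivative q) * D ^ 2 := by
    linear_combination (D * q) * h' - (derivative D * q + D * derivative q) * h
  rw [div_eq_div_iff (pow_ne_zero 2 hd') (pow_ne_zero 2 hq'), ← map_pow, ← map_pow,
    ← map_mul, ← map_mul, key]

/-- On polynomials `ratDeriv` is the usual derivative. -/
theorem ratDeriv_algebraMap (p : ℂ[X]) :
    ratDeriv (algebraMap ℂ[X] (RatFunc ℂ) p) = algebraMap ℂ[X] (RatFunc ℂ) (derivative p) := by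
  simpa using ratDeriv_div p 1 one_ne_zero

/-- The right-hand side `-z [f f'' - (f')²] - f f' + (z + μ) f²` of the recurrence relation. -/
noncomputable def umemuraRHS (μ : ℂ) (f : RatFunc ℂ) : RatFunc ℂ :=
  -RatFunc.X * (f * ratDeriv (ratDeriv f) - ratDeriv f ^ 2) - f * ratDeriv f +
    (RatFunc.X + RatFunc.C μ) * f ^ 2

/-- The sequence `S₋₁, S₀, S₁, …`, with the index shifted by one: `umemuraSeq μ k` is `S_{k-1}`.
The division is that of the field `ℂ(z)`; if some term vanished then so would all later ones, so
finding arbitrarily late nonzero terms includes that the recurrence never divides by zero. -/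
noncomputable def umemuraSeq (μ : ℂ) : ℕ → RatFunc ℂ
  | 0 => 1
  | 1 => 1
  | k + 2 => umemuraRHS μ (umemuraSeq μ (k + 1)) / umemuraSeq μ k

/-- The rational function `S_n(z; μ)`, for `n ≥ 0`, generated by `S₋₁ = S₀ = 1` and
`S_{n+1} S_{n-1} = -z [S_n S_n'' - (S_n')²] - S_n S_n' + (z + μ) S_n²`. -/
noncomputable def umemuraS (μ : ℂ) (n : ℕ) : RatFunc ℂ :=
  umemuraSeq μ (n + 1)

/-! Write `a`, `b`, `c` for consecutive terms, so that `op μ b = c * a`. Two bilinear identities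
drive the induction: D²(a, b) = 0 and the Wronskian relation c'a - ca' = (2n+1)b². They reproduce
each other through `op_mul_identity`, and they force `a ∣ op μ b`, so every term is a polynomial.

Away from 0, `op μ b` equals z b'(z)² at a root of `b`, so simplicity of the roots of `b` separates
them from those of `c`; the Wronskian relation then makes the roots of `c` simple.

At 0, a recursion with factor μ² - (k+1)² keeps the values nonzero up to S_{|μ|} and makes S_{|μ|+1}
vanish. From there the Wronskian relation makes the order of vanishing have second difference 1,
which gives triangular numbers. -/

namespace Umemura

/-- The right-hand side of the recurrence relation, on polynomials. -/
noncomputable def op (μ : ℂ) (f : ℂ[X]) : ℂ[X] :=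
  -X * (f * derivative (derivative f) - derivative f ^ 2) - f * derivative f + (X + C μ) * f ^ 2

/-- Hirota's operator `D²` applied to the pair `(a, b)`. -/
noncomputable def hirota (a b : ℂ[X]) : ℂ[X] :=
  derivative (derivative a) * b - 2 * derivative a * derivative b + a * derivative (derivative b)

/-! ### Algebra of the recurrence operator -/

theorem umemuraRHS_algebraMap (μ : ℂ) (f : ℂ[X]) :
    umemuraRHS μ (algebraMap ℂ[X] (RatFunc ℂ) f) = algebraMap ℂ[X] (RatFunc ℂ) (op μ f) := by
  simp only [umemuraRHS, op, ratDeriv_algebraMap, map_add, map_sub, map_mul, map_neg, map_pow,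
    RatFunc.algebraMap_X, RatFunc.algebraMap_C]

theorem eval_op (μ z : ℂ) (f : ℂ[X]) :
    (op μ f).eval z = -z * (f.eval z * (derivative (derivative f)).eval z -
      (derivative f).eval z ^ 2) - f.eval z * (derivative f).eval z + (z + μ) * f.eval z ^ 2 := by
  simp [op]

theorem X_mul_derivative_X_pow (m : ℕ) : X * derivative (X ^ m : ℂ[X]) = C (m : ℂ) * X ^ m := by
  cases m with
  | zero => simp
  | succ m => rw [derivative_X_pow, Nat.add_sub_cancel]; ring

/-- Formally op f = f²(z + μ - (z f'/f)'), and a factor z^m shifts z f'/f by the constant m. -/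
theorem op_X_pow_mul (μ : ℂ) (m : ℕ) (f : ℂ[X]) : op μ (X ^ m * f) = X ^ (2 * m) * op μ f := by
  have hm := X_mul_derivative_X_pow m
  rw [pow_mul']
  generalize (X ^ m : ℂ[X]) = w at hm ⊢
  have hm' := congrArg derivative hm
  simp only [derivative_mul, derivative_X, derivative_C, one_mul, zero_mul, zero_add] at hm'
  simp only [op, derivative_mul, derivative_add]
  linear_combination f ^ 2 * (derivative w * hm - w * hm')

theorem op_mul_identity (μ : ℂ) (b c : ℂ[X]) :
    b * (derivative (op μ c) * b - 2 * op μ c * derivative b) -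
        c * (2 * derivative c * op μ b - c * derivative (op μ b)) =
      2 * b ^ 2 * c ^ 2 - 2 * hirota b c * (b * c) -
        X * (derivative (hirota b c) * (b * c) - hirota b c * derivative (b * c)) := by
  simp only [op, hirota, derivative_add, derivative_sub, derivative_mul, derivative_neg,
    derivative_X, derivative_C, derivative_ofNat, pow_two]
  ring

theorem monic_op (μ : ℂ) {f : ℂ[X]} (hf : f.Monic) :
    (op μ f).Monic ∧ (op μ f).natDegree = 2 * f.natDegree + 1 := by
  have hlead : (X * f ^ 2).Monic := monic_X.mul (hf.pow 2)
  have hdeg : (X * f ^ 2).natDegree = 2 * f.natDegree + 1 := by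
    rw [monic_X.natDegree_mul (hf.pow 2), hf.natDegree_pow, natDegree_X, add_comm]
  have hop : op μ f = X * f ^ 2 + (-X * (f * derivative (derivative f) - derivative f ^ 2) -
      f * derivative f + C μ * f ^ 2) := by
    rw [op]; ring
  have h1 : (derivative f).natDegree ≤ f.natDegree - 1 := natDegree_derivative_le f
  have h2 : (derivative (derivative f)).natDegree ≤ f.natDegree - 1 - 1 :=
    (natDegree_derivative_le _).trans (Nat.sub_le_sub_right h1 1)
  have hlt : (-X * (f * derivative (derivative f) - derivative f ^ 2) -
      f * derivative f + C μ * f ^ 2).degree < (X * f ^ 2).degree := by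
    rw [degree_eq_natDegree hlead.ne_zero, hdeg]
    refine lt_of_le_of_lt (b := ((2 * f.natDegree : ℕ) : WithBot ℕ)) ?_
      (by exact_mod_cast Nat.lt_succ_self _)
    rw [← natDegree_le_iff_degree_le]
    rcases Nat.eq_zero_or_pos f.natDegree with h0 | h0
    · have : f = 1 := hf.natDegree_eq_zero.mp h0
      simp [this]
    · have h3 : (X : ℂ[X]).natDegree ≤ 1 := natDegree_X_le
      have h4 : (derivative f ^ 2).natDegree ≤ 2 * (f.natDegree - 1) :=
        natDegree_pow_le_of_le 2 h1
      have h5 : (f * derivative (derivative f)).natDegree ≤ f.natDegree + (f.natDegree - 1 - 1) :=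
        natDegree_mul_le_of_le le_rfl h2
      have h6 : (-X * (f * derivative (derivative f) - derivative f ^ 2)).natDegree ≤
          1 + (2 * f.natDegree - 1) :=
        natDegree_mul_le_of_le (by rwa [natDegree_neg])
          (natDegree_sub_le_of_le (h5.trans (by lia)) (h4.trans (by lia)) |>.trans (max_self _).le)
      have h7 : (f * derivative f).natDegree ≤ f.natDegree + (f.natDegree - 1) :=
        natDegree_mul_le_of_le le_rfl h1
      have h8 : (C μ * f ^ 2).natDegree ≤ 2 * f.natDegree :=
        (natDegree_C_mul_le _ _).trans (natDegree_pow_le_of_le 2 le_rfl)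
      exact (natDegree_add_le_of_degree_le
        ((natDegree_sub_le_of_le (h6.trans (by lia)) (h7.trans (by lia))).trans
          (max_self (2 * f.natDegree)).le) h8)
  rw [hop]
  refine ⟨hlead.add_of_left hlt, ?_⟩
  rw [natDegree_add_eq_left_of_degree_lt hlt, hdeg]

theorem isCoprime_of_no_common_root {p q : ℂ[X]} (h : ∀ z, p.eval z = 0 → q.eval z ≠ 0) :
    IsCoprime p q := by
  rw [isCoprime_iff_aeval_ne_zero_of_isAlgClosed ℂ ℂ]
  simpa [coe_aeval_eq_eval, ← imp_iff_not_or] using h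

theorem exists_eq_X_pow_mul {f : ℂ[X]} (hf : f ≠ 0) :
    ∃ q : ℂ[X], f = X ^ f.rootMultiplicity 0 * q ∧ q.eval 0 ≠ 0 := by
  obtain ⟨q, hq, hd⟩ := exists_eq_pow_rootMultiplicity_mul_and_not_dvd f hf 0
  refine ⟨q, by simpa using hq, ?_⟩
  rwa [dvd_iff_isRoot] at hd

theorem rootMultiplicity_zero_X_pow_mul (m : ℕ) {q : ℂ[X]} (hq : q.eval 0 ≠ 0) :
    (X ^ m * q).rootMultiplicity 0 = m := by
  have hq0 : q ≠ 0 := by rintro rfl; simp at hq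
  rw [rootMultiplicity_mul (mul_ne_zero (pow_ne_zero _ X_ne_zero) hq0),
    rootMultiplicity_eq_zero hq]
  simpa using rootMultiplicity_X_sub_C_pow (0 : ℂ) m

theorem le_rootMultiplicity_op (μ : ℂ) {f : ℂ[X]} (hf : f ≠ 0) :
    X ^ (2 * f.rootMultiplicity 0) ∣ op μ f := by
  obtain ⟨q, hq, -⟩ := exists_eq_X_pow_mul hf
  generalize f.rootMultiplicity 0 = m at hq
  rw [hq, op_X_pow_mul]
  exact dvd_mul_right _ _

/-- The order at `0` of three nonzero polynomials with `W(a, c) = N b²`. -/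
theorem rootMultiplicity_add_of_wronskian {a b c : ℂ[X]} {N : ℂ} (hN : N ≠ 0) (ha : a ≠ 0)
    (hb : b ≠ 0) (hc : c ≠ 0) (h : derivative c * a - c * derivative a = C N * b ^ 2)
    (hne : c.rootMultiplicity 0 ≠ a.rootMultiplicity 0) :
    c.rootMultiplicity 0 + a.rootMultiplicity 0 = 2 * b.rootMultiplicity 0 + 1 := by
  obtain ⟨p, hp, hp0⟩ := exists_eq_X_pow_mul ha
  obtain ⟨r, hr, hr0⟩ := exists_eq_X_pow_mul hb
  obtain ⟨q, hq, hq0⟩ := exists_eq_X_pow_mul hc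
  generalize a.rootMultiplicity 0 = i at *
  generalize b.rootMultiplicity 0 = k at *
  generalize c.rootMultiplicity 0 = j at *
  -- X times the Wronskian relation; the cofactor on the left has constant term (j - i)q(0)p(0),
  -- nonzero because the orders differ.
  have key : X ^ (j + i) * (C ((j : ℂ) - i) * q * p + X * (derivative q * p - q * derivative p)) =
      X ^ (2 * k + 1) * (C N * r ^ 2) := by
    subst hp hq hr
    simp only [derivative_mul] at h
    have hi := X_mul_derivative_X_pow i
    have hj := X_mul_derivative_X_pow j
    rw [C_sub]
    linear_combination X * h - q * X ^ i * p * hj + X ^ j * q * p * hi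
  have hL := rootMultiplicity_zero_X_pow_mul (j + i)
    (q := C ((j : ℂ) - i) * q * p + X * (derivative q * p - q * derivative p)) (by
      simpa [sub_eq_zero, hp0, hq0] using hne)
  have hR := rootMultiplicity_zero_X_pow_mul (2 * k + 1) (q := C N * r ^ 2) (by simp [hN, hr0])
  rw [← hL, key, hR]

/-- The properties of two consecutive terms `a = S_{n-1}` and `b = S_n` that pass on to the
next pair. -/
structure Consecutive (μ : ℂ) (n : ℕ) (a b : ℂ[X]) : Prop where
  monic_left : a.Monic
  monic_right : b.Monic
  natDegree_left : a.natDegree + n = b.natDegree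
  natDegree_right : 2 * b.natDegree = n * (n + 1)
  hirota_eq_zero : hirota a b = 0
  derivative_op : derivative (op μ b) * a - 2 * op μ b * derivative a =
    C (2 * n + 1 : ℂ) * a * b ^ 2
  ne_zero_of_left : ∀ z ≠ 0, a.eval z = 0 → b.eval z ≠ 0
  simple_left : ∀ z ≠ 0, a.eval z = 0 → (derivative a).eval z ≠ 0
  simple_right : ∀ z ≠ 0, b.eval z = 0 → (derivative b).eval z ≠ 0
  rootMultiplicity_le : a.rootMultiplicity 0 ≤ b.rootMultiplicity 0

theorem consecutive_one_one (μ : ℂ) : Consecutive μ 0 1 1 where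
  monic_left := monic_one
  monic_right := monic_one
  natDegree_left := rfl
  natDegree_right := by simp
  hirota_eq_zero := by simp [hirota]
  derivative_op := by simp [op]
  ne_zero_of_left := by simp
  simple_left := by simp
  simple_right := by simp
  rootMultiplicity_le := le_rfl

/-! ### Divisibility and the inductive step -/

namespace Consecutive

variable {μ : ℂ} {n : ℕ} {a b c : ℂ[X]}

/-- Split a = X^m q with q(0) ≠ 0. The power of X divides because `op μ b` vanishes at 0 to at least
twice the order of `b`; q divides 2 (op b) a' and is coprime to a', its roots being simple roots of
`a`. -/
theorem dvd_op (h : Consecutive μ n a b) : a ∣ op μ b := by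
  obtain ⟨q, hq, hq0⟩ := exists_eq_X_pow_mul h.monic_left.ne_zero
  have hqX : IsCoprime (X ^ a.rootMultiplicity 0) q := by
    refine IsCoprime.pow_left (isCoprime_of_no_common_root fun z hz => ?_)
    rw [eval_X] at hz
    rwa [hz]
  have hqa : IsCoprime q (derivative a) := by
    refine isCoprime_of_no_common_root fun z hz => h.simple_left z ?_ ?_
    · rintro rfl
      exact hq0 hz
    · rw [hq, eval_mul, hz, mul_zero]
  have hXd : X ^ a.rootMultiplicity 0 ∣ op μ b :=
    (pow_dvd_pow _ (by have := h.rootMultiplicity_le; lia)).trans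
      (le_rootMultiplicity_op μ h.monic_right.ne_zero)
  have hqd : q ∣ op μ b := by
    have hqa' : q ∣ a := ⟨_, hq.trans (mul_comm _ _)⟩
    have h2 : q ∣ 2 * op μ b * derivative a := by
      have : 2 * op μ b * derivative a =
          a * (derivative (op μ b) - C (2 * n + 1 : ℂ) * b ^ 2) := by
        linear_combination -h.derivative_op
      rw [this]
      exact hqa'.mul_right _
    have h3 := hqa.dvd_of_dvd_mul_right h2
    rwa [show (2 : ℂ[X]) = C 2 from rfl, dvd_C_mul two_ne_zero] at h3
  rw [hq]
  exact hqX.mul_dvd hXd hqd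

/-- `derivative_op` is this relation multiplied by `a`, phrased without the quotient `c` so that it
can be used before divisibility is known. -/
theorem wronskian (h : Consecutive μ n a b) (hc : op μ b = c * a) :
    derivative c * a - c * derivative a = C (2 * n + 1 : ℂ) * b ^ 2 := by
  have h1 := h.derivative_op
  rw [hc, derivative_mul] at h1
  refine mul_left_cancel₀ h.monic_left.ne_zero ?_
  linear_combination h1

theorem succ (h : Consecutive μ n a b) (hc : op μ b = c * a) : Consecutive μ (n + 1) b c := by
  have hw := h.wronskian hc
  obtain ⟨hm, hd⟩ := monic_op μ h.monic_right
  rw [hc] at hm hd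
  have hcm : c.Monic := h.monic_left.of_mul_monic_right hm
  have hN : (2 * n + 1 : ℂ) ≠ 0 := by exact_mod_cast (2 * n).succ_ne_zero
  have hB : hirota b c = 0 := by
    have hw' := congrArg derivative hw
    have hB := h.hirota_eq_zero
    rw [hirota] at hB ⊢
    simp only [derivative_sub, derivative_mul, derivative_C, pow_two, zero_mul, zero_add] at hw'
    -- With W = c'a - ca': a D²(b, c) = bW' - 2b'W + c D²(a, b), and W = (2n+1)b² cancels the first
    -- two terms.
    refine mul_left_cancel₀ h.monic_left.ne_zero ?_
    linear_combination b * hw' - 2 * derivative b * hw + c * hB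
  have hbc : ∀ z ≠ 0, b.eval z = 0 → c.eval z ≠ 0 := by
    intro z hz hb hc0
    have := congrArg (eval z) hc
    rw [eval_op, eval_mul, hb, hc0] at this
    simp [hz, h.simple_right z hz hb] at this
  have := h.natDegree_left
  have := h.natDegree_right
  have hdeg := hcm.natDegree_mul h.monic_left
  refine ⟨h.monic_right, hcm, by lia, by nlinarith, hB, ?_, hbc, h.simple_right, ?_, ?_⟩
  · have hid := op_mul_identity μ b c
    rw [hB, hc, derivative_mul] at hid
    refine mul_left_cancel₀ h.monic_right.ne_zero ?_
    -- The increment 2 comes from the term 2b²c² of `op_mul_identity`.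
    have hN2 : C (2 * ((n + 1 : ℕ) : ℂ) + 1) = C (2 * n + 1 : ℂ) + 2 := by
      rw [← map_ofNat C 2, ← C_add]
      push_cast
      ring_nf
    simp only [derivative_zero, mul_zero, zero_mul, sub_zero] at hid
    rw [hN2]
    linear_combination hid + c ^ 2 * hw
  · intro z hz hc0 hc1
    have := congrArg (eval z) hw
    simp only [eval_sub, eval_mul, hc0, hc1, eval_C, eval_pow, zero_mul, sub_zero] at this
    exact hbc z hz (by simpa [hN] using this.symm) hc0
  -- ord c + ord a ≥ 2 ord b and ord a ≤ ord b give ord b ≤ ord c.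
  · have h1 := (le_rootMultiplicity_iff (hc ▸ hm.ne_zero) (a := (0 : ℂ))).mpr
      (by simpa using le_rootMultiplicity_op μ h.monic_right.ne_zero)
    rw [hc, rootMultiplicity_mul hm.ne_zero] at h1
    have := h.rootMultiplicity_le
    lia

end Consecutive

/-! ### The polynomial sequence and its values at 0 -/

/-- The polynomials `S₋₁, S₀, S₁, …`, with the index shifted by one. -/
noncomputable def poly (μ : ℂ) : ℕ → ℂ[X]
  | 0 => 1
  | 1 => 1
  | k + 2 => op μ (poly μ (k + 1)) / poly μ k

theorem op_poly_of_consecutive {μ : ℂ} {n : ℕ}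
    (h : Consecutive μ n (poly μ n) (poly μ (n + 1))) :
    op μ (poly μ (n + 1)) = poly μ (n + 2) * poly μ n := by
  rw [poly, mul_comm]
  exact (EuclideanDomain.mul_div_cancel' h.monic_left.ne_zero h.dvd_op).symm

theorem consecutive_poly (μ : ℂ) (n : ℕ) : Consecutive μ n (poly μ n) (poly μ (n + 1)) := by
  induction n with
  | zero => exact consecutive_one_one μ
  | succ n ih => exact ih.succ (op_poly_of_consecutive ih)

theorem op_poly (μ : ℂ) (n : ℕ) : op μ (poly μ (n + 1)) = poly μ (n + 2) * poly μ n :=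
  op_poly_of_consecutive (consecutive_poly μ n)

theorem poly_ne_zero (μ : ℂ) (n : ℕ) : poly μ n ≠ 0 := (consecutive_poly μ n).monic_left.ne_zero

theorem poly_two (μ : ℂ) : poly μ 2 = X + C μ := by
  have := op_poly μ 0
  simp only [poly, op] at this ⊢
  simp

theorem umemuraSeq_eq (μ : ℂ) (n : ℕ) :
    umemuraSeq μ n = algebraMap ℂ[X] (RatFunc ℂ) (poly μ n) := by
  induction n using Nat.twoStepInduction with
  | zero => simp [umemuraSeq, poly]
  | one => simp [umemuraSeq, poly]
  | more n h0 h1 =>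
    rw [umemuraSeq, h0, h1, umemuraRHS_algebraMap, op_poly, map_mul,
      mul_div_cancel_right₀ _ (RatFunc.algebraMap_ne_zero (poly_ne_zero μ n))]

theorem eval_zero_poly (μ : ℂ) (k : ℕ) (h : ∀ j ≤ k + 1, (poly μ j).eval 0 ≠ 0) :
    (poly μ (k + 3)).eval 0 * (poly μ k).eval 0 =
      (μ ^ 2 - (k + 1) ^ 2) * ((poly μ (k + 2)).eval 0 * (poly μ (k + 1)).eval 0) := by
  have toda : ∀ n, (poly μ (n + 2)).eval 0 * (poly μ n).eval 0 =
      μ * (poly μ (n + 1)).eval 0 ^ 2 -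
        (poly μ (n + 1)).eval 0 * (derivative (poly μ (n + 1))).eval 0 := by
    intro n
    rw [← eval_mul, ← op_poly, eval_op]
    ring
  induction k with
  | zero =>
    have := toda 1
    have h1 : poly μ 1 = 1 := rfl
    have h0 : poly μ 0 = 1 := rfl
    simp [poly_two, h0, h1] at this ⊢
    linear_combination this
  | succ k ih =>
    have ih := ih fun j hj => h j (by lia)
    have hw := congrArg (eval 0) ((consecutive_poly μ (k + 1)).wronskian (op_poly μ (k + 1)))
    have t1 := toda k
    have t2 := toda (k + 2)
    simp only [eval_sub, eval_mul, eval_C, eval_pow] at hw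
    refine mul_left_cancel₀ (mul_ne_zero (h (k + 1) (by lia)) (h (k + 2) le_rfl)) ?_
    push_cast at hw ⊢
    -- The Wronskian relation eliminates the derivatives in `t1` and `t2`; its constant is 2k + 3 =
    -- (k+2)² - (k+1)².
    linear_combination (poly μ (k + 1)).eval 0 ^ 2 * t2 - (poly μ (k + 3)).eval 0 ^ 2 * t1 +
      (poly μ (k + 2)).eval 0 * (poly μ (k + 3)).eval 0 * ih -
      (poly μ (k + 1)).eval 0 * (poly μ (k + 3)).eval 0 * hw

/-! ### Order of vanishing at 0 for integer μ -/

section Integer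

variable (μ : ℤ)

theorem eval_zero_poly_ne_zero (k : ℕ) (hk : k ≤ μ.natAbs + 1) : (poly μ k).eval 0 ≠ 0 := by
  induction k using Nat.strong_induction_on with
  | _ k ih =>
    match k with
    | 0 => simp [poly]
    | 1 => simp [poly]
    | 2 => simp [poly_two]; lia
    | k + 3 =>
      have h := eval_zero_poly μ k fun j hj => ih j (by lia) (by lia)
      refine left_ne_zero_of_mul (b := (poly μ k).eval 0) ?_
      rw [h]
      refine mul_ne_zero ?_ (mul_ne_zero (ih _ (by lia) (by lia)) (ih _ (by lia) (by lia)))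
      rw [sub_ne_zero]
      intro h2
      have h3 : μ ^ 2 = ((k : ℤ) + 1) ^ 2 := by exact_mod_cast h2
      rw [← Int.natAbs_eq_iff_sq_eq] at h3
      lia

theorem eval_zero_poly_eq_zero : (poly μ (μ.natAbs + 2)).eval 0 = 0 := by
  rcases hM : μ.natAbs with _ | k
  · simpa [poly_two] using hM
  · have h := eval_zero_poly μ k fun j hj => eval_zero_poly_ne_zero μ j (by lia)
    have h2 : (μ : ℂ) ^ 2 = (k + 1) ^ 2 := by
      have : μ ^ 2 = ((k : ℤ) + 1) ^ 2 := by
        rw [← Int.natAbs_sq, hM]; push_cast; rfl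
      exact_mod_cast this
    rw [h2, sub_self, zero_mul] at h
    exact (mul_eq_zero.mp h).resolve_right (eval_zero_poly_ne_zero μ k (by lia))

theorem rootMultiplicity_poly_add_two (n : ℕ)
    (h : (poly μ (n + 2)).rootMultiplicity 0 ≠ (poly μ n).rootMultiplicity 0) :
    (poly μ (n + 2)).rootMultiplicity 0 + (poly μ n).rootMultiplicity 0 =
      2 * (poly μ (n + 1)).rootMultiplicity 0 + 1 :=
  rootMultiplicity_add_of_wronskian (by exact_mod_cast (2 * n).succ_ne_zero) (poly_ne_zero _ _)
    (poly_ne_zero _ _) (poly_ne_zero _ _) ((consecutive_poly μ n).wronskian (op_poly μ n)) h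

theorem rootMultiplicity_poly (j : ℕ) :
    2 * (poly μ (μ.natAbs + 1 + j)).rootMultiplicity 0 = j * (j + 1) ∧
      (poly μ (μ.natAbs + 1 + j)).rootMultiplicity 0 + (j + 1) =
        (poly μ (μ.natAbs + 1 + (j + 1))).rootMultiplicity 0 := by
  induction j with
  | zero =>
    have h0 := rootMultiplicity_eq_zero (eval_zero_poly_ne_zero μ μ.natAbs (by lia))
    have h1 := rootMultiplicity_eq_zero (eval_zero_poly_ne_zero μ (μ.natAbs + 1) le_rfl)
    have h2 : 0 < (poly μ (μ.natAbs + 2)).rootMultiplicity 0 :=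
      (rootMultiplicity_pos (poly_ne_zero _ _)).mpr (eval_zero_poly_eq_zero μ)
    have h3 := rootMultiplicity_poly_add_two μ μ.natAbs (by lia)
    simp only [add_assoc, zero_add, add_zero, Nat.reduceAdd] at *
    lia
  | succ j ih =>
    have h2 := rootMultiplicity_poly_add_two μ (μ.natAbs + 1 + j)
    have h1 := (consecutive_poly μ (μ.natAbs + 1 + (j + 1))).rootMultiplicity_le
    simp only [add_assoc] at *
    refine ⟨by nlinarith, ?_⟩
    -- The orders differ: they do not decrease at this step (`h1`) and rose by j + 1 at the previous
    -- one.
    have := h2 (by lia)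
    lia

end Integer

end Umemura

theorem theorem3p4 (μ : ℤ) (n : ℕ) (hn : |μ| < (n : ℤ)) :
    ∃ P : ℂ[X],
      umemuraS (μ : ℂ) n = algebraMap ℂ[X] (RatFunc ℂ) P ∧
      (2 * (P.rootMultiplicity 0 : ℤ) = ((n : ℤ) - |μ|) * ((n : ℤ) - |μ| + 1)) ∧
      P.Monic ∧
      2 * P.natDegree = n * (n + 1) ∧
      ∀ z : ℂ, z ≠ 0 → P.IsRoot z → P.rootMultiplicity z = 1 := by
  have h := Umemura.consecutive_poly μ n
  refine ⟨Umemura.poly μ (n + 1), Umemura.umemuraSeq_eq μ (n + 1), ?_, h.monic_right, h.natDegree_right, ?_⟩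
  · rw [Int.abs_eq_natAbs] at hn ⊢
    obtain ⟨j, rfl⟩ : ∃ j, n = μ.natAbs + j := ⟨n - μ.natAbs, by lia⟩
    have hj := (Umemura.rootMultiplicity_poly μ j).1
    rw [add_right_comm] at hj
    push_cast
    rw [add_sub_cancel_left]
    exact_mod_cast hj
  · intro z hz hr
    refine le_antisymm ?_ ((rootMultiplicity_pos h.monic_right.ne_zero).mpr hr)
    by_contra! h1
    exact h.simple_right z hz hr
      ((one_lt_rootMultiplicity_iff_isRoot h.monic_right.ne_zero).mp h1).2
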